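/- Let $M$ be a smooth ($C^\infty$, finite-dimensional, Hausdorff) manifold without boundary and let $p$ be a smooth bivector field on $M$, i.e. a smooth assignment $x\mapsto p(x)\in\wedge^2T_xM$ (not necessarily Poisson). For a covector $\alpha\in T_x^*M$ let $\tilde p(\alpha)\in T_xM$ be the vector determined by $\beta(\tilde p(\alpha))=(\alpha\wedge\beta)(p(x))$ for all $\beta\in T_x^*M$, put $\pi(x)=\{\tilde p(\alpha):\alpha\in T_x^*M\}\subset T_xM$, and put $\{f,g\}=(df\wedge dg)(p)$ for $f,g\in C^\infty(M)$. The differential system (possibly singular distribution) $\pi$ is called involutive if for any two vector fields $X=\sum_i\varphi_i\,\tilde p(df_i)$ and $Y=\sum_j\psi_j\,\tilde p(dg_j)$ (finite sums, $\varphi_i,f_i,\psi_j,g_j\in C^\infty(M)$) one has $[X,Y](x)\in\pi(x)$ for every $x\in M$. Let $[p,p]$ be the Schouten bracket of $p$ with itself, i.e. the field of trivectors with $$(df\wedge dg\wedge dh)([p,p])=2\big(\{\{f,g\},h\}+\{\{g,h\},f\}+\{\{h,f\},g\}\big)\qquad\text{for all } f,g,h\in C^\infty(M).$$ Then $\pi$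 is involutive if and only if $$[p,p](x)\in\pi(x)\wedge\pi(x)\wedge\pi(x)\subset\wedge^3T_xM\qquad\text{for every } x\in M.$$ -/

import Mathlib

open scoped Manifold ContDiff

namespace Multivector

section LinearAlgebra
variable {V : Type*} [AddCommGroup V] [Module ℝ V]

/-- The value `(α₁ ∧ ⋯ ∧ αₖ)(T)` of a product of covectors on a `k`-vector, normalised by
`(α₁ ∧ ⋯ ∧ αₖ)(v₁ ∧ ⋯ ∧ vₖ) = det (αⱼ vᵢ)`. -/
noncomputable def wedgeEval {k : ℕ} (α : Fin k → Module.Dual ℝ V) (T : ⋀[ℝ]^k V) : ℝ :=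
  exteriorPower.pairingDual ℝ V k (exteriorPower.ιMulti ℝ k α) T

theorem update_pair_zero {X : Type*} (a b c : X) :
    Function.update ![a, c] 0 b = ![b, c] := by
  ext i; fin_cases i <;> rfl

theorem update_pair_one {X : Type*} (a b c : X) :
    Function.update ![a, c] 1 b = ![a, b] := by
  ext i; fin_cases i <;> rfl

/-- A bivector as a bilinear form on covectors, `(α, β) ↦ (α ∧ β)(P)`. -/
noncomputable def bivectorForm (P : ⋀[ℝ]^2 V) :
    Module.Dual ℝ V →ₗ[ℝ] Module.Dual ℝ V →ₗ[ℝ] ℝ :=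
  LinearMap.mk₂ ℝ (fun α β => wedgeEval ![α, β] P)
    (fun a b c => by
      have := (exteriorPower.ιMulti ℝ 2).map_update_add ![a, c] 0 a b
      simp only [update_pair_zero] at this
      simp only [wedgeEval, this, map_add, LinearMap.add_apply])
    (fun r a c => by
      have := (exteriorPower.ιMulti ℝ 2).map_update_smul ![a, c] 0 r a
      simp only [update_pair_zero] at this
      simp only [wedgeEval, this, map_smul, LinearMap.smul_apply])
    (fun a b c => by
      have := (exteriorPower.ιMulti ℝ 2).map_update_add ![a, c] 1 b c
      simp only [update_pair_one] at this
      simp only [wedgeEval, this, map_add, LinearMap.add_apply])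
    (fun r a c => by
      have := (exteriorPower.ιMulti ℝ 2).map_update_smul ![a, c] 1 r c
      simp only [update_pair_one] at this
      simp only [wedgeEval, this, map_smul, LinearMap.smul_apply])

theorem bivectorForm_apply (P : ⋀[ℝ]^2 V) (α β : Module.Dual ℝ V) :
    bivectorForm P α β = wedgeEval ![α, β] P := rfl

theorem bivectorForm_self (P : ⋀[ℝ]^2 V) (α : Module.Dual ℝ V) : bivectorForm P α α = 0 := by
  rw [bivectorForm_apply, wedgeEval, (exteriorPower.ιMulti ℝ 2).map_eq_zero_of_eq ![α, α]
    (i := 0) (j := 1) rfl (by decide)]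
  simp

theorem bivectorForm_swap (P : ⋀[ℝ]^2 V) (α β : Module.Dual ℝ V) :
    bivectorForm P α β = - bivectorForm P β α := by
  have h := bivectorForm_self P (α + β)
  simp only [map_add, LinearMap.add_apply, bivectorForm_self] at h
  linarith

/-- The contraction `α ↦ P̃(α)`, characterised by `β (P̃ α) = (α ∧ β)(P)`. -/
noncomputable def bivectorSharp [FiniteDimensional ℝ V] (P : ⋀[ℝ]^2 V) :
    Module.Dual ℝ V →ₗ[ℝ] V :=
  (Module.evalEquiv ℝ V).symm.toLinearMap ∘ₗ bivectorForm P

theorem apply_bivectorSharp [FiniteDimensional ℝ V] (P : ⋀[ℝ]^2 V) (α β : Module.Dual ℝ V) :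
    β (bivectorSharp P α) = wedgeEval ![α, β] P := by
  simp [bivectorSharp, bivectorForm_apply]

/-- `W ∧ ⋯ ∧ W` (`k` factors) as a subspace of the `k`-th exterior power of `V`. -/
noncomputable def wedgePower (k : ℕ) (W : Submodule ℝ V) : Submodule ℝ (⋀[ℝ]^k V) :=
  LinearMap.range (exteriorPower.map k W.subtype)

/-- Covectors separate `k`-vectors, and every alternating form on covectors is a `k`-vector. -/
theorem existsUnique_wedgeEval_eq [FiniteDimensional ℝ V] {k : ℕ}
    (G : (Module.Dual ℝ V) [⋀^Fin k]→ₗ[ℝ] ℝ) :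
    ∃! T : ⋀[ℝ]^k V, ∀ α, wedgeEval α T = G α := by
  set Ψ : ⋀[ℝ]^k V →ₗ[ℝ] Module.Dual ℝ (⋀[ℝ]^k (Module.Dual ℝ V)) :=
    (exteriorPower.pairingDual ℝ V k).flip with hΨ
  have hval : ∀ α T, Ψ T (exteriorPower.ιMulti ℝ k α) = wedgeEval α T := fun α T => rfl
  have hinj : Function.Injective Ψ := by
    rw [injective_iff_map_eq_zero]
    intro T hT
    let b := Module.finBasis ℝ V
    apply (b.exteriorPower (n := k)).ext_elem
    intro s
    rw [exteriorPower.basis_repr_apply]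
    have := hval (fun j => b.coord (Set.powersetCard.ofFinEmbEquiv.symm s j)) T
    rw [hT] at this
    simp only [map_zero, Finsupp.coe_zero, Pi.zero_apply]
    exact this.symm
  have hsurj : Function.Surjective Ψ := by
    refine (LinearMap.injective_iff_surjective_of_finrank_eq_finrank ?_).1 hinj
    rw [Subspace.dual_finrank_eq, exteriorPower.finrank_eq, exteriorPower.finrank_eq,
      Subspace.dual_finrank_eq]
  obtain ⟨T, hT⟩ := hsurj (exteriorPower.alternatingMapLinearEquiv G)
  refine ⟨T, fun α => ?_, fun T' hT' => ?_⟩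
  · rw [← hval, hT]; simp
  · apply hinj
    rw [hT]
    apply exteriorPower.linearMap_ext
    ext α
    simpa [hval] using hT' α

end LinearAlgebra
end Multivector

section Manifold
variable {n : ℕ} {M : Type*} [TopologicalSpace M] [ChartedSpace (EuclideanSpace ℝ (Fin n)) M]

/-- The differential `df(x)` as a linear form on the tangent space. -/
noncomputable def differentialAt (f : C^∞⟮𝓡 n, M; ℝ⟯) (x : M) :
    Module.Dual ℝ (TangentSpace (𝓡 n) x) :=
  (mvfderiv (𝓡 n) f x).toLinearMap

instance finiteDimensional_tangentSpace (x : M) : FiniteDimensional ℝ (TangentSpace (𝓡 n) x) :=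
  inferInstanceAs (FiniteDimensional ℝ (EuclideanSpace ℝ (Fin n)))

variable (n M) in
/-- A smooth bivector field: an element of the second exterior power of each tangent space,
depending smoothly on the point, i.e. `(df ∧ dg)(p)` is a smooth function for all smooth functions
`f` and `g` (equivalently, the components of `p` in local coordinates are smooth). -/
structure BivectorField where
  toFun : ∀ x : M, ⋀[ℝ]^2 (TangentSpace (𝓡 n) x)
  contMDiff_wedgeEval : ∀ f g : C^∞⟮𝓡 n, M; ℝ⟯,
    ContMDiff (𝓡 n) 𝓘(ℝ, ℝ) ∞
      fun x => Multivector.wedgeEval ![differentialAt f x, differentialAt g x] (toFun x)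

namespace BivectorField

/-- `{f, g} = (df ∧ dg)(p)`. -/
noncomputable def bracket (p : BivectorField n M) (f g : C^∞⟮𝓡 n, M; ℝ⟯) : C^∞⟮𝓡 n, M; ℝ⟯ :=
  ⟨_, p.contMDiff_wedgeEval f g⟩

/-- The vector field `p̃(df) = {f, ·}`. -/
noncomputable def hamiltonianField (p : BivectorField n M) (f : C^∞⟮𝓡 n, M; ℝ⟯) (x : M) :
    TangentSpace (𝓡 n) x :=
  Multivector.bivectorSharp (p.toFun x) (differentialAt f x)

/-- The possibly singular distribution `π`: `π(x)` is the set of the vectors `p̃(α)` for `α` in the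
cotangent space at `x`. -/
noncomputable def differentialSystem (p : BivectorField n M) (x : M) :
    Submodule ℝ (TangentSpace (𝓡 n) x) :=
  LinearMap.range (Multivector.bivectorSharp (p.toFun x))

/-- The vector fields spanned by the `p̃(df)` over the algebra of smooth functions: the finite sums
`∑ φᵢ p̃(dfᵢ)`. -/
def spannedFields (p : BivectorField n M) : Set (∀ x : M, TangentSpace (𝓡 n) x) :=
  {X | ∃ (k : ℕ) (φ f : Fin k → C^∞⟮𝓡 n, M; ℝ⟯),
    X = fun x => ∑ i, φ i x • p.hamiltonianField (f i) x}

/-- `π` is involutive: the commutator of any two of the vector fields that span `π` takes its values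
in `π`. -/
def IsInvolutive (p : BivectorField n M) : Prop :=
  ∀ X ∈ p.spannedFields, ∀ Y ∈ p.spannedFields, ∀ x : M,
    VectorField.mlieBracket (𝓡 n) X Y x ∈ p.differentialSystem x

/-- The compositional product `p ∘ q` of two skew biderivations of the algebra of functions: the
sum over all permutations `s` of three letters with `s 1 < s 2` of
`sgn s • p (q (f (s 1), f (s 2)), f (s 3))`. -/
noncomputable def compProd (p q : BivectorField n M) (f g h : C^∞⟮𝓡 n, M; ℝ⟯) :
    C^∞⟮𝓡 n, M; ℝ⟯ :=
  p.bracket (q.bracket f g) h - p.bracket (q.bracket f h) g + p.bracket (q.bracket g h) f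

/-- The supercommutator `[p, q] = (-1)^((2 + 1) * 2) p ∘ q + (-1)^2 q ∘ p = p ∘ q + q ∘ p`, as a skew
triderivation of the algebra of functions. -/
noncomputable def schoutenDerivation (p q : BivectorField n M) (f g h : C^∞⟮𝓡 n, M; ℝ⟯) :
    C^∞⟮𝓡 n, M; ℝ⟯ :=
  compProd p q f g h + compProd q p f g h

theorem bracket_apply (p : BivectorField n M) (f g : C^∞⟮𝓡 n, M; ℝ⟯) (x : M) :
    p.bracket f g x =
      Multivector.bivectorForm (p.toFun x) (differentialAt f x) (differentialAt g x) := rfl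

theorem differentialAt_hamiltonianField (p : BivectorField n M) (f g : C^∞⟮𝓡 n, M; ℝ⟯) (x : M) :
    differentialAt g x (p.hamiltonianField f x) = p.bracket f g x :=
  Multivector.apply_bivectorSharp _ _ _

theorem bracket_swap (p : BivectorField n M) (f g : C^∞⟮𝓡 n, M; ℝ⟯) :
    p.bracket f g = - p.bracket g f := by
  ext x
  exact Multivector.bivectorForm_swap _ _ _

theorem bracket_self (p : BivectorField n M) (f : C^∞⟮𝓡 n, M; ℝ⟯) : p.bracket f f = 0 := by
  ext x
  exact Multivector.bivectorForm_self _ _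

theorem mdifferentiableAt_coe (f : C^∞⟮𝓡 n, M; ℝ⟯) (x : M) :
    MDifferentiableAt (𝓡 n) 𝓘(ℝ, ℝ) f x :=
  (f.contMDiff x).mdifferentiableAt (by simp)

theorem differentialAt_add (f g : C^∞⟮𝓡 n, M; ℝ⟯) (x : M) :
    differentialAt (f + g) x = differentialAt f x + differentialAt g x := by
  have := mvfderiv_add (mdifferentiableAt_coe f x) (mdifferentiableAt_coe g x)
  rw [differentialAt, ContMDiffMap.coe_add, this]; rfl

theorem differentialAt_smul (r : ℝ) (f : C^∞⟮𝓡 n, M; ℝ⟯) (x : M) :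
    differentialAt (r • f) x = r • differentialAt f x := by
  have := mvfderiv_smul (mdifferentiableAt_const (I := 𝓡 n) (c := r) (x := x))
    (mdifferentiableAt_coe f x)
  have h2 : ⇑(r • f) = (fun _ : M => r) • ⇑f := rfl
  rw [differentialAt, h2, this]
  ext v
  have h3 : mvfderiv (𝓡 n) (fun _ : M => r) x = 0 := mvfderiv_const r
  simp [differentialAt, h3]

theorem bracket_add_left (p : BivectorField n M) (f g h : C^∞⟮𝓡 n, M; ℝ⟯) :
    p.bracket (f + g) h = p.bracket f h + p.bracket g h := by
  ext x; simp [bracket_apply, differentialAt_add]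

theorem bracket_smul_left (p : BivectorField n M) (r : ℝ) (f h : C^∞⟮𝓡 n, M; ℝ⟯) :
    p.bracket (r • f) h = r • p.bracket f h := by
  ext x; simp [bracket_apply, differentialAt_smul]

theorem bracket_add_right (p : BivectorField n M) (f g h : C^∞⟮𝓡 n, M; ℝ⟯) :
    p.bracket f (g + h) = p.bracket f g + p.bracket f h := by
  ext x; simp [bracket_apply, differentialAt_add]

theorem bracket_smul_right (p : BivectorField n M) (r : ℝ) (f h : C^∞⟮𝓡 n, M; ℝ⟯) :
    p.bracket f (r • h) = r • p.bracket f h := by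
  ext x; simp [bracket_apply, differentialAt_smul]

theorem schoutenDerivation_swap_left (p q : BivectorField n M) (f g h : C^∞⟮𝓡 n, M; ℝ⟯) :
    schoutenDerivation p q f g h = - schoutenDerivation p q g f h := by
  have hneg : ∀ (r : BivectorField n M) (u v : C^∞⟮𝓡 n, M; ℝ⟯),
      r.bracket (-u) v = - r.bracket u v := fun r u v => by
    rw [← neg_one_smul ℝ u, bracket_smul_left, neg_one_smul]
  simp only [schoutenDerivation, compProd]
  rw [bracket_swap q f g, bracket_swap p f g, hneg, hneg]
  abel

theorem schoutenDerivation_swap_right (p q : BivectorField n M) (f g h : C^∞⟮𝓡 n, M; ℝ⟯) :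
    schoutenDerivation p q f g h = - schoutenDerivation p q f h g := by
  have hneg : ∀ (r : BivectorField n M) (u v : C^∞⟮𝓡 n, M; ℝ⟯),
      r.bracket (-u) v = - r.bracket u v := fun r u v => by
    rw [← neg_one_smul ℝ u, bracket_smul_left, neg_one_smul]
  simp only [schoutenDerivation, compProd]
  rw [bracket_swap q g h, bracket_swap p g h, hneg, hneg]
  abel

theorem mvfderiv_eq_of_hasMFDerivAt {u : M → ℝ} {x : M} {L : TangentSpace (𝓡 n) x →L[ℝ] ℝ}
    (h : HasMFDerivAt (𝓡 n) 𝓘(ℝ, ℝ) u x L) (v : TangentSpace (𝓡 n) x) :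
    mvfderiv (𝓡 n) u x v = L v := by
  rw [mvfderiv, h.mfderiv]; rfl

/-- The chain rule for a function on the model space composed with a map to it. -/
theorem hasMFDerivAt_fderiv_comp {Φ : M → EuclideanSpace ℝ (Fin n)} {x : M}
    (hΦ : MDifferentiableAt (𝓡 n) (𝓡 n) Φ x) {F : EuclideanSpace ℝ (Fin n) → ℝ}
    {L : EuclideanSpace ℝ (Fin n) →L[ℝ] ℝ} (hF : HasFDerivAt F L (Φ x)) :
    HasMFDerivAt (𝓡 n) 𝓘(ℝ, ℝ) (F ∘ Φ) x (L.comp (mfderiv (𝓡 n) (𝓡 n) Φ x)) :=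
  hF.hasMFDerivAt.comp x hΦ.hasMFDerivAt

variable [IsManifold (𝓡 n) ∞ M] [T2Space M]

/-- There is a smooth map to the model space which agrees with a given chart near its centre. -/
theorem exists_globalChart (x : M) : ∃ Φ : M → EuclideanSpace ℝ (Fin n),
    ContMDiff (𝓡 n) (𝓡 n) ∞ Φ ∧ Φ =ᶠ[nhds x] extChartAt (𝓡 n) x := by
  let χ : SmoothBumpFunction (𝓡 n) x := Classical.arbitrary _
  refine ⟨fun y => χ y • extChartAt (𝓡 n) x y, χ.contMDiff_smul ?_, ?_⟩
  · simpa using contMDiffOn_extChartAt (I := 𝓡 n) (n := ∞) (x := x)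
  · filter_upwards [χ.eventuallyEq_one] with y hy
    simp [hy]

theorem differentialAt_surjective (x : M) :
    Function.Surjective fun f : C^∞⟮𝓡 n, M; ℝ⟯ => differentialAt f x := by
  intro α
  obtain ⟨Φ, hΦ, hΦx⟩ := exists_globalChart (n := n) x
  have hinv := isInvertible_mfderiv_extChartAt (I := 𝓡 n) (mem_extChartAt_source (I := 𝓡 n) x)
  obtain ⟨e, he⟩ := hinv
  let α' : EuclideanSpace ℝ (Fin n) →L[ℝ] ℝ := LinearMap.toContinuousLinearMap
    (show EuclideanSpace ℝ (Fin n) →ₗ[ℝ] ℝ from α ∘ₗ e.symm.toLinearMap)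
  refine ⟨⟨fun y => α' (Φ y), α'.contMDiff.comp hΦ⟩, ?_⟩
  ext v
  change mvfderiv (𝓡 n) (α' ∘ Φ) x v = α v
  rw [mvfderiv_eq_of_hasMFDerivAt (hasMFDerivAt_fderiv_comp ((hΦ x).mdifferentiableAt (by simp))
    α'.hasFDerivAt), hΦx.mfderiv_eq, ← he]
  change α (e.symm (e v)) = α v
  rw [e.symm_apply_apply]

/-- Second derivatives commute at a critical point. -/
theorem differentialAt_comm_of_eq_zero (p q : BivectorField n M) (f g h : C^∞⟮𝓡 n, M; ℝ⟯) (x : M)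
    (hf : differentialAt f x = 0) :
    p.bracket g (q.bracket h f) x = q.bracket h (p.bracket g f) x := by
  obtain ⟨Φ, hΦ, hΦx⟩ := exists_globalChart (n := n) x
  have hΦd : ∀ y, MDifferentiableAt (𝓡 n) (𝓡 n) Φ y := fun y => (hΦ y).mdifferentiableAt (by simp)
  let F : EuclideanSpace ℝ (Fin n) → ℝ := f ∘ (extChartAt (𝓡 n) x).symm
  have hF : ContDiffOn ℝ ∞ F (extChartAt (𝓡 n) x).target := by
    rw [← contMDiffOn_iff_contDiffOn]
    exact f.contMDiff.comp_contMDiffOn (contMDiffOn_extChartAt_symm x)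
  have hopen : IsOpen (extChartAt (𝓡 n) x).target := isOpen_extChartAt_target x
  have hxs : extChartAt (𝓡 n) x x ∈ (extChartAt (𝓡 n) x).target := mem_extChartAt_target x
  have hΦxx : Φ x = extChartAt (𝓡 n) x x := hΦx.eq_of_nhds
  -- the differential of `f` near `x`
  have hdf : ∀ᶠ y in nhds x, Φ y ∈ (extChartAt (𝓡 n) x).target ∧ ∀ v,
      differentialAt f y v = fderiv ℝ F (Φ y) (mfderiv (𝓡 n) (𝓡 n) Φ y v) := by
    have hsrc : (extChartAt (𝓡 n) x).source ∈ nhds x := extChartAt_source_mem_nhds x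
    filter_upwards [hΦx.eventuallyEq_nhds, eventually_mem_nhds_iff.2 hsrc] with y hy hys
    have hyt : Φ y ∈ (extChartAt (𝓡 n) x).target := by
      rw [hy.eq_of_nhds]; exact (extChartAt (𝓡 n) x).map_source (mem_of_mem_nhds hys)
    refine ⟨hyt, fun v => ?_⟩
    have hfF : ⇑f =ᶠ[nhds y] F ∘ Φ := by
      filter_upwards [hy, hys] with z hz hzs
      change f z = f ((extChartAt (𝓡 n) x).symm (Φ z))
      rw [hz, (extChartAt (𝓡 n) x).left_inv hzs]
    have hFd : DifferentiableAt ℝ F (Φ y) :=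
      (hF.contDiffAt (hopen.mem_nhds hyt)).differentiableAt (by simp)
    exact mvfderiv_eq_of_hasMFDerivAt
      ((hasMFDerivAt_fderiv_comp (hΦd y) hFd.hasFDerivAt).congr_of_eventuallyEq hfF) v
  -- coordinates
  let Φc : Fin n → C^∞⟮𝓡 n, M; ℝ⟯ := fun i => ⟨fun y => Φ y i, by
    exact (EuclideanSpace.proj (𝕜 := ℝ) i).contMDiff.comp hΦ⟩
  have hΦc : ∀ i y (v : TangentSpace (𝓡 n) y), differentialAt (Φc i) y v =
      EuclideanSpace.proj (𝕜 := ℝ) i (mfderiv (𝓡 n) (𝓡 n) Φ y v) := fun i y v =>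
    mvfderiv_eq_of_hasMFDerivAt
      (hasMFDerivAt_fderiv_comp (hΦd y) (EuclideanSpace.proj (𝕜 := ℝ) i).hasFDerivAt) v
  have hD0 : fderiv ℝ F (Φ x) = 0 := by
    obtain ⟨e, he⟩ :=
      isInvertible_mfderiv_extChartAt (I := 𝓡 n) (mem_extChartAt_source (I := 𝓡 n) x)
    ext z
    have h1 := (hdf.self_of_nhds).2 (e.symm z)
    rw [hf, hΦx.mfderiv_eq, ← he] at h1
    exact (congrArg (fderiv ℝ F (Φ x)) (e.apply_symm_apply z)).symm.trans h1.symm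
  have hD2 : DifferentiableAt ℝ (fderiv ℝ F) (Φ x) := by
    have := (hF.contDiffAt (hopen.mem_nhds (hΦxx ▸ hxs)))
    exact (this.fderiv_right (m := 1) (by norm_cast)).differentiableAt (by simp)
  let w : BivectorField n M → C^∞⟮𝓡 n, M; ℝ⟯ → EuclideanSpace ℝ (Fin n) := fun r u =>
    mfderiv (𝓡 n) (𝓡 n) Φ x (r.hamiltonianField u x)
  have key : ∀ (r s : BivectorField n M) (u v : C^∞⟮𝓡 n, M; ℝ⟯),
      s.bracket v (r.bracket u f) x = fderiv ℝ (fderiv ℝ F) (Φ x) (w s v) (w r u) := by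
    intro r s u v
    let b := EuclideanSpace.basisFun (Fin n) ℝ
    have hsum : ∀ z : EuclideanSpace ℝ (Fin n), z = ∑ i, z i • b i := fun z => by
      simpa [b] using (b.sum_repr z).symm
    have hloc : ⇑(r.bracket u f) =ᶠ[nhds x]
        fun y => ∑ i, fderiv ℝ F (Φ y) (b i) * r.bracket u (Φc i) y := by
      filter_upwards [hdf] with y hy
      rw [← differentialAt_hamiltonianField, hy.2]
      conv_lhs => rw [hsum (mfderiv (𝓡 n) (𝓡 n) Φ y (r.hamiltonianField u y)), map_sum]
      refine Finset.sum_congr rfl fun i _ => ?_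
      rw [map_smul, ← differentialAt_hamiltonianField, hΦc, smul_eq_mul, mul_comm]
      rfl
    have hder : ∀ i, HasMFDerivAt (𝓡 n) 𝓘(ℝ, ℝ)
        (fun y => fderiv ℝ F (Φ y) (b i) * r.bracket u (Φc i) y) x
        ((r.bracket u (Φc i) x) • (((fderiv ℝ (fderiv ℝ F) (Φ x)).flip (b i)).comp
          (mfderiv (𝓡 n) (𝓡 n) Φ x))) := by
      intro i
      have h1 : HasFDerivAt (fun z => fderiv ℝ F z (b i))
          ((fderiv ℝ (fderiv ℝ F) (Φ x)).flip (b i)) (Φ x) := by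
        simpa using hD2.hasFDerivAt.clm_apply (hasFDerivAt_const (b i) (Φ x))
      have h2 := (hasMFDerivAt_fderiv_comp (hΦd x) h1).mul'
        (mdifferentiableAt_coe (r.bracket u (Φc i)) x).hasMFDerivAt
      have h3 : fderiv ℝ F (Φ x) (b i) = 0 := by rw [hD0]; rfl
      refine h2.congr_mfderiv ?_
      ext z
      change fderiv ℝ F (Φ x) (b i) * _ + _ * _ = _
      rw [h3, zero_mul, zero_add, mul_comm]
      rfl
    rw [← differentialAt_hamiltonianField]
    refine (mvfderiv_eq_of_hasMFDerivAt
      ((HasMFDerivAt.sum (t := Finset.univ) (fun i _ => hder i)).congr_of_eventuallyEq ?_) _).trans ?_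
    · filter_upwards [hloc] with y hy
      simp [hy]
    · rw [hsum (w r u), map_sum, _root_.sum_apply]
      refine Finset.sum_congr rfl fun i _ => ?_
      rw [map_smul, ← differentialAt_hamiltonianField, hΦc]
      rfl
  rw [key, key]
  have hsymm : IsSymmSndFDerivAt ℝ F (Φ x) :=
    (hF.contDiffAt (hopen.mem_nhds (hΦxx ▸ hxs))).isSymmSndFDerivAt
      (by simp only [minSmoothness_of_isRCLikeNormedField]; exact WithTop.coe_le_coe.2 (le_top : (2 : ℕ∞) ≤ ⊤))
  exact hsymm _ _

theorem schoutenDerivation_eq_zero (p q : BivectorField n M) (f g h : C^∞⟮𝓡 n, M; ℝ⟯) (x : M)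
    (hf : differentialAt f x = 0) : schoutenDerivation p q f g h x = 0 := by
  have h1 := differentialAt_comm_of_eq_zero p q f g h x hf
  have h2 := differentialAt_comm_of_eq_zero q p f g h x hf
  have e1 : ∀ (r : BivectorField n M) u, r.bracket u f x = 0 := fun r u => by
    simp [bracket_apply, hf]
  have e2 : ∀ (r s : BivectorField n M) (u v : C^∞⟮𝓡 n, M; ℝ⟯),
      r.bracket (s.bracket f u) v x = r.bracket v (s.bracket u f) x := fun r s u v => by
    have h3 : s.bracket f u = (-1 : ℝ) • s.bracket u f := by
      rw [bracket_swap s f u]; simp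
    rw [bracket_swap r, h3, bracket_smul_right]; simp
  simp only [schoutenDerivation, compProd, ContMDiffMap.coe_add, ContMDiffMap.coe_sub, Pi.add_apply,
    Pi.sub_apply, e1, e2]
  linarith

/-- A skew triderivation of the algebra of functions is a field of trivectors: there is exactly one
trivector at `x` whose value on `df ∧ dg ∧ dh` is `[p, q](f, g, h)(x)` for all `f`, `g`, `h`. -/
theorem existsUnique_schoutenBracket (p q : BivectorField n M) (x : M) :
    ∃! T : ⋀[ℝ]^3 (TangentSpace (𝓡 n) x), ∀ f g h : C^∞⟮𝓡 n, M; ℝ⟯,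
      Multivector.wedgeEval ![differentialAt f x, differentialAt g x, differentialAt h x] T =
        schoutenDerivation p q f g h x := by
  let S : C^∞⟮𝓡 n, M; ℝ⟯ → C^∞⟮𝓡 n, M; ℝ⟯ → C^∞⟮𝓡 n, M; ℝ⟯ → ℝ := fun f g h =>
    schoutenDerivation p q f g h x
  have hS1 : ∀ f g h, S f g h = - S g f h := fun f g h => by
    simp only [S]; rw [schoutenDerivation_swap_left]; rfl
  have hS2 : ∀ f g h, S f g h = - S f h g := fun f g h => by
    simp only [S]; rw [schoutenDerivation_swap_right]; rfl
  have hadd1 : ∀ f f' g h, S (f + f') g h = S f g h + S f' g h := fun f f' g h => by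
    simp only [S, schoutenDerivation, compProd, bracket_add_left, bracket_add_right,
      ContMDiffMap.coe_add, ContMDiffMap.coe_sub, Pi.add_apply, Pi.sub_apply]
    ring
  have hsmul1 : ∀ (r : ℝ) f g h, S (r • f) g h = r * S f g h := fun r f g h => by
    simp only [S, schoutenDerivation, compProd, bracket_smul_left, bracket_smul_right,
      ContMDiffMap.coe_add, ContMDiffMap.coe_sub, ContMDiffMap.coe_smul, Pi.add_apply,
      Pi.sub_apply, Pi.smul_apply, smul_eq_mul]
    ring
  have hadd2 : ∀ f g g' h, S f (g + g') h = S f g h + S f g' h := fun f g g' h => by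
    rw [hS1, hadd1, hS1 f g, hS1 f g']; ring
  have hsmul2 : ∀ (r : ℝ) f g h, S f (r • g) h = r * S f g h := fun r f g h => by
    rw [hS1, hsmul1, hS1 f g]; ring
  have hadd3 : ∀ f g h h', S f g (h + h') = S f g h + S f g h' := fun f g h h' => by
    rw [hS2, hadd2, hS2 f g h, hS2 f g h']; ring
  have hsmul3 : ∀ (r : ℝ) f g h, S f g (r • h) = r * S f g h := fun r f g h => by
    rw [hS2, hsmul2, hS2 f g h]; ring
  have halt1 : ∀ f h, S f f h = 0 := fun f h => by linarith [hS1 f f h]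
  have halt2 : ∀ f g, S f g g = 0 := fun f g => by linarith [hS2 f g g]
  have halt3 : ∀ f g, S f g f = 0 := fun f g => by rw [hS1, halt2, neg_zero]
  -- descent to differentials
  have hcongr1 : ∀ f f' g h, differentialAt f x = differentialAt f' x → S f g h = S f' g h := by
    intro f f' g h hff
    have h0 : S (f + (-1 : ℝ) • f') g h = 0 := by
      apply schoutenDerivation_eq_zero
      rw [differentialAt_add, differentialAt_smul, hff]
      ext v
      change differentialAt f' x v + (-1) * differentialAt f' x v = 0
      ring
    rw [hadd1, hsmul1] at h0
    linarith
  have hcongr : ∀ f f' g g' h h', differentialAt f x = differentialAt f' x →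
      differentialAt g x = differentialAt g' x → differentialAt h x = differentialAt h' x →
      S f g h = S f' g' h' := by
    intro f f' g g' h h' hf hg hh
    rw [hcongr1 f f' g h hf, hS1, hcongr1 g g' f' h hg, ← hS1, hS2, hS1, hcongr1 h h' f' g' hh,
      ← hS1, ← hS2]
  let D : C^∞⟮𝓡 n, M; ℝ⟯ →ₗ[ℝ] Module.Dual ℝ (TangentSpace (𝓡 n) x) :=
    { toFun := fun f => differentialAt f x
      map_add' := fun f g => differentialAt_add f g x
      map_smul' := fun r f => differentialAt_smul r f x }
  obtain ⟨s, hs⟩ := D.exists_rightInverse_of_surjective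
    (LinearMap.range_eq_top.2 (differentialAt_surjective x))
  have hsD : ∀ α, differentialAt (s α) x = α := fun α => LinearMap.congr_fun hs α
  let G : (Module.Dual ℝ (TangentSpace (𝓡 n) x)) [⋀^Fin 3]→ₗ[ℝ] ℝ :=
    { toFun := fun α => S (s (α 0)) (s (α 1)) (s (α 2))
      map_update_add' := by
        intro inst m i a b
        obtain rfl : inst = instDecidableEqFin 3 := Subsingleton.elim _ _
        fin_cases i <;> simp [hadd1, hadd2, hadd3]
      map_update_smul' := by
        intro inst m i r a
        obtain rfl : inst = instDecidableEqFin 3 := Subsingleton.elim _ _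
        fin_cases i <;> simp [hsmul1, hsmul2, hsmul3]
      map_eq_zero_of_eq' := by
        intro v i j hv hij
        have h3 : v 0 = v 1 ∨ v 1 = v 2 ∨ v 2 = v 0 := by
          fin_cases i <;> fin_cases j <;>
            first
            | exact absurd rfl hij
            | exact Or.inl hv
            | exact Or.inl hv.symm
            | exact Or.inr (Or.inl hv)
            | exact Or.inr (Or.inl hv.symm)
            | exact Or.inr (Or.inr hv)
            | exact Or.inr (Or.inr hv.symm)
        rcases h3 with h | h | h
        · rw [h, halt1]
        · rw [h, halt2]
        · rw [h, halt3] }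
  have hG : ∀ f g h : C^∞⟮𝓡 n, M; ℝ⟯,
      G ![differentialAt f x, differentialAt g x, differentialAt h x] = S f g h := fun f g h =>
    hcongr _ _ _ _ _ _ (hsD _) (hsD _) (hsD _)
  obtain ⟨T, hT, huniq⟩ := Multivector.existsUnique_wedgeEval_eq G
  refine ⟨T, fun f g h => ?_, fun T' hT' => huniq T' fun α => ?_⟩
  · simp only [hT, hG]; rfl
  · have hα : α = ![differentialAt (s (α 0)) x, differentialAt (s (α 1)) x,
        differentialAt (s (α 2)) x] := by
      ext i : 1
      fin_cases i <;> exact (hsD _).symm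
    rw [hα, hT', hG]

/-- The Schouten bracket `[p, q]` of two bivector fields, a field of trivectors. -/
noncomputable def schoutenBracket (p q : BivectorField n M) (x : M) :
    ⋀[ℝ]^3 (TangentSpace (𝓡 n) x) :=
  (existsUnique_schoutenBracket p q x).choose

theorem wedgeEval_schoutenBracket (p q : BivectorField n M) (x : M) (f g h : C^∞⟮𝓡 n, M; ℝ⟯) :
    Multivector.wedgeEval ![differentialAt f x, differentialAt g x, differentialAt h x]
      (schoutenBracket p q x) = schoutenDerivation p q f g h x :=
  (existsUnique_schoutenBracket p q x).choose_spec.1 f g h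

end BivectorField
end Manifold

/-! ### Exterior powers of a subspace, tested by covectors. -/

namespace Multivector
variable {V : Type*} [AddCommGroup V] [Module ℝ V]

/-! Both conditions are pointwise and can be tested on covectors `γ` that annihilate `π(x)`. A
vector lies in `π(x)` iff all such `γ` kill it, and a trivector lies in `⋀³ π(x)` iff it vanishes on
`α ∧ β ∧ γ` for all `α`, `β` and all such `γ` (`mem_wedgePower_three_iff`).

Write `γ = dh(x)`. Then `{u, h}(x) = 0` for every `u`. For `X = ∑ φᵢ p̃(dfᵢ)` and `Y = ∑ ψⱼ
p̃(dgⱼ)`, the number `γ([X, Y])` is `X(Y h) - Y(X h)` at `x`. The terms with derivatives of `φᵢ` or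
`ψⱼ` carry a factor `{fᵢ, h}(x)` or `{gⱼ, h}(x)` and vanish, which leaves `∑ φᵢ ψⱼ ({fᵢ, {gⱼ, h}} -
{gⱼ, {fᵢ, h}})(x)`. In the Jacobi sum for `[p, p]` the term `{{fᵢ, gⱼ}, h}(x)` vanishes too, so each
summand is `-1/2` times `(dfᵢ ∧ dgⱼ ∧ γ)([p, p])`. This identity, `annihilator_mlieBracket_apply`,
gives both implications, because every covector at `x` is the differential of a global function.

The analytic ingredient is `exists_differentialAt_mlieBracket`, which turns the bracket of vector
fields, defined through charts, into a commutator of derivations. -/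

theorem wedgeEval_map {V' : Type*} [AddCommGroup V'] [Module ℝ V'] {k : ℕ} (F : V →ₗ[ℝ] V')
    (α : Fin k → Module.Dual ℝ V') (T : ⋀[ℝ]^k V) :
    wedgeEval α (exteriorPower.map k F T) = wedgeEval (fun i => α i ∘ₗ F) T := by
  have h : (exteriorPower.pairingDual ℝ V' k (exteriorPower.ιMulti ℝ k α)) ∘ₗ
      exteriorPower.map k F =
      exteriorPower.pairingDual ℝ V k (exteriorPower.ιMulti ℝ k fun i => α i ∘ₗ F) := by
    apply exteriorPower.linearMap_ext
    ext v
    simp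
  exact LinearMap.congr_fun h T

/-- Evaluation at a fixed `k`-vector as an alternating form on covectors. -/
noncomputable def wedgeForm {k : ℕ} (T : ⋀[ℝ]^k V) : (Module.Dual ℝ V) [⋀^Fin k]→ₗ[ℝ] ℝ :=
  ((exteriorPower.pairingDual ℝ V k).flip T).compAlternatingMap (exteriorPower.ιMulti ℝ k)

theorem wedgeForm_apply {k : ℕ} (T : ⋀[ℝ]^k V) (α : Fin k → Module.Dual ℝ V) :
    wedgeForm T α = wedgeEval α T := rfl

/-- A `k`-vector lies in `⋀ᵏ W` iff it is killed by all products of covectors with a factor that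
annihilates `W`. -/
theorem mem_wedgePower_iff [FiniteDimensional ℝ V] {k : ℕ} (W : Submodule ℝ V) (T : ⋀[ℝ]^k V) :
    T ∈ wedgePower k W ↔
      ∀ α : Fin k → Module.Dual ℝ V, (∃ i, α i ∈ W.dualAnnihilator) → wedgeEval α T = 0 := by
  constructor
  · rintro ⟨S, rfl⟩ α ⟨i, hi⟩
    rw [wedgeEval_map, ← wedgeForm_apply]
    refine AlternatingMap.map_coord_zero _ i ?_
    ext w
    exact (Submodule.mem_dualAnnihilator _).1 hi _ w.2
  · intro h
    -- A linear projection `r` of `V` onto `W` supplies the candidate preimage of `T`. Covectors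
    -- separate `k`-vectors, so it remains to compare values.
    obtain ⟨r, hr⟩ := W.subtype.exists_leftInverse_of_injective W.ker_subtype
    refine ⟨exteriorPower.map k r T, ?_⟩
    refine (existsUnique_wedgeEval_eq (wedgeForm T)).unique (fun α => ?_) fun α => rfl
    rw [wedgeEval_map, wedgeEval_map, wedgeForm_apply]
    set β : Fin k → Module.Dual ℝ V := fun i => (α i ∘ₗ W.subtype) ∘ₗ r with hβ
    have hann : ∀ i, (α - β) i ∈ W.dualAnnihilator := fun i => by
      rw [Submodule.mem_dualAnnihilator]
      intro w hw
      have : r w = ⟨w, hw⟩ := LinearMap.congr_fun hr ⟨w, hw⟩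
      simp [hβ, this]
    -- Expand `α = β + (α - β)` in every slot. Each term other than the one with `β` throughout has
    -- a factor `α i - β i`, which annihilates `W`.
    have hsum := (wedgeForm T).map_add_univ β (α - β)
    rw [add_sub_cancel, Finset.sum_eq_single Finset.univ, Finset.piecewise_univ] at hsum
    · exact hsum.symm
    · intro s _ hs
      obtain ⟨i, hi⟩ : ∃ i, i ∉ s := by
        by_contra! hall
        exact hs (Finset.eq_univ_iff_forall.2 hall)
      refine h _ ⟨i, ?_⟩
      rw [Finset.piecewise_eq_of_notMem _ _ _ hi]
      exact hann i
    · simp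

/-- It is enough to test the last factor. -/
theorem mem_wedgePower_three_iff [FiniteDimensional ℝ V] (W : Submodule ℝ V) (T : ⋀[ℝ]^3 V) :
    T ∈ wedgePower 3 W ↔
      ∀ α β γ : Module.Dual ℝ V, γ ∈ W.dualAnnihilator → wedgeEval ![α, β, γ] T = 0 := by
  rw [mem_wedgePower_iff]
  constructor
  · exact fun h α β γ hγ => h _ ⟨2, hγ⟩
  · rintro h α ⟨i, hi⟩
    have hlast : ∀ δ : Fin 3 → Module.Dual ℝ V, δ 2 ∈ W.dualAnnihilator → wedgeForm T δ = 0 := by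
      intro δ hδ
      have hδ' : δ = ![δ 0, δ 1, δ 2] := by
        ext j : 1
        fin_cases j <;> rfl
      rw [hδ']
      exact h _ _ _ hδ
    rw [← wedgeForm_apply]
    by_cases hi2 : i = 2
    · exact hlast α (hi2 ▸ hi)
    · have hswap := (wedgeForm T).map_swap α hi2
      rw [hlast _ (by simpa using hi)] at hswap
      linarith

/-- Immediate from `γ (P̃ α) = (α ∧ γ)(P)`. It supplies the vanishing of all `{u, h}(x)` when
`dh(x)` annihilates `π(x)`. -/
theorem mem_range_bivectorSharp_dualAnnihilator_iff [FiniteDimensional ℝ V] (P : ⋀[ℝ]^2 V)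
    (γ : Module.Dual ℝ V) :
    γ ∈ (LinearMap.range (bivectorSharp P)).dualAnnihilator ↔ ∀ α, bivectorForm P α γ = 0 := by
  simp [Submodule.mem_dualAnnihilator, apply_bivectorSharp, bivectorForm_apply]

end Multivector

/-! ### Spanning fields as derivations of the algebra of functions. -/

namespace BivectorField
open VectorField
variable {n : ℕ} {M : Type*} [TopologicalSpace M] [ChartedSpace (EuclideanSpace ℝ (Fin n)) M]

/-- The derivation of the algebra of functions given by `∑ φᵢ p̃(dfᵢ)`. -/
noncomputable def spannedDerivation (p : BivectorField n M) {k : ℕ}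
    (φ f : Fin k → C^∞⟮𝓡 n, M; ℝ⟯) (u : C^∞⟮𝓡 n, M; ℝ⟯) : C^∞⟮𝓡 n, M; ℝ⟯ :=
  ∑ i, φ i * p.bracket (f i) u

theorem spannedDerivation_apply (p : BivectorField n M) {k : ℕ}
    (φ f : Fin k → C^∞⟮𝓡 n, M; ℝ⟯) (u : C^∞⟮𝓡 n, M; ℝ⟯) (x : M) :
    spannedDerivation p φ f u x = ∑ i, φ i x * p.bracket (f i) u x := by
  have h := map_sum (ContMDiffMap.coeFnAddMonoidHom (I := 𝓡 n) (N := M) (I' := 𝓘(ℝ, ℝ)) (G := ℝ)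
    (n := ∞)) (fun i => φ i * p.bracket (f i) u) Finset.univ
  have h' := congrFun h x
  rw [Finset.sum_apply] at h'
  exact h'

theorem differentialAt_sum_smul_hamiltonianField (p : BivectorField n M) {k : ℕ}
    (φ f : Fin k → C^∞⟮𝓡 n, M; ℝ⟯) (u : C^∞⟮𝓡 n, M; ℝ⟯) (x : M) :
    differentialAt u x (∑ i, φ i x • p.hamiltonianField (f i) x) =
      spannedDerivation p φ f u x := by
  rw [spannedDerivation_apply, map_sum]
  refine Finset.sum_congr rfl fun i _ => ?_
  rw [map_smul, differentialAt_hamiltonianField, smul_eq_mul]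

theorem differentialAt_mul (f g : C^∞⟮𝓡 n, M; ℝ⟯) (x : M) :
    differentialAt (f * g) x = f x • differentialAt g x + g x • differentialAt f x := by
  have h := (mdifferentiableAt_coe f x).hasMFDerivAt.mul' (mdifferentiableAt_coe g x).hasMFDerivAt
  ext v
  refine (mvfderiv_eq_of_hasMFDerivAt h v).trans ?_
  change f x * _ + _ * g x = f x * _ + g x * _
  rw [mul_comm (_ : ℝ) (g x)]
  rfl

/-- In the Leibniz rule the terms with `dφᵢ` carry the factor `{fᵢ, u}(x) = 0`. Hence derivatives of
the coefficients never enter the commutator modulo `π`. -/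
theorem differentialAt_spannedDerivation (p : BivectorField n M) {k : ℕ}
    (φ f : Fin k → C^∞⟮𝓡 n, M; ℝ⟯) (u : C^∞⟮𝓡 n, M; ℝ⟯) (x : M)
    (h : ∀ i, p.bracket (f i) u x = 0) :
    differentialAt (spannedDerivation p φ f u) x =
      ∑ i, φ i x • differentialAt (p.bracket (f i) u) x := by
  refine (map_sum (AddMonoidHom.mk' (fun u : C^∞⟮𝓡 n, M; ℝ⟯ => differentialAt u x)
    fun u v => differentialAt_add u v x) _ _).trans (Finset.sum_congr rfl fun i _ => ?_)
  change differentialAt (φ i * p.bracket (f i) u) x = _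
  rw [differentialAt_mul, h, zero_smul, add_zero]

/-! ### The bracket of vector fields in a chart. -/

variable [IsManifold (𝓡 n) ∞ M]

theorem isManifold_one : IsManifold (𝓡 n) 1 M := IsManifold.of_le (n := ∞) (by simp)

variable (n) in
/-- A vector field read in the extended chart at `x`. -/
noncomputable def chartField (x : M) (X : ∀ x : M, TangentSpace (𝓡 n) x) :
    EuclideanSpace ℝ (Fin n) → EuclideanSpace ℝ (Fin n) :=
  mpullbackWithin 𝓘(ℝ, EuclideanSpace ℝ (Fin n)) (𝓡 n) (extChartAt (𝓡 n) x).symm X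
    (Set.range (𝓡 n))

/-- The derivatives of the chart and of its inverse are mutually inverse, so pulling back along the
inverse chart is pushing forward along the chart. -/
theorem chartField_apply (x : M) (X : ∀ x : M, TangentSpace (𝓡 n) x)
    {y : M} (hy : y ∈ (extChartAt (𝓡 n) x).source) :
    chartField n x X (extChartAt (𝓡 n) x y) =
      mfderiv (𝓡 n) (𝓡 n) (extChartAt (𝓡 n) x) y (X y) := by
  have := isManifold_one (n := n) (M := M)
  have hyt := (extChartAt (𝓡 n) x).map_source hy
  have h := mfderivWithin_extChartAt_symm_comp_mfderiv_extChartAt hyt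
  have h' := mfderiv_extChartAt_comp_mfderivWithin_extChartAt_symm hyt
  rw [chartField, mpullbackWithin_apply, ContinuousLinearMap.inverse_eq h h',
    (extChartAt (𝓡 n) x).left_inv hy]

/-- The manifold bracket is by definition the model-space bracket transported by the inverse of the
chart's derivative, which cancels here. No regularity of `X` or `Y` is needed. -/
theorem mfderiv_extChartAt_mlieBracket (x : M) (X Y : ∀ x : M, TangentSpace (𝓡 n) x) :
    mfderiv (𝓡 n) (𝓡 n) (extChartAt (𝓡 n) x) x (mlieBracket (𝓡 n) X Y x) =
      lieBracket ℝ (chartField n x X) (chartField n x Y) (extChartAt (𝓡 n) x x) := by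
  have := isManifold_one (n := n) (M := M)
  have hinv := isInvertible_mfderiv_extChartAt (I := 𝓡 n) (mem_extChartAt_source (I := 𝓡 n) x)
  rw [← mlieBracketWithin_univ, mlieBracketWithin_apply]
  obtain ⟨e, he⟩ := hinv
  rw [← he, ContinuousLinearMap.inverse_equiv]
  refine (e.apply_symm_apply _).trans ?_
  simp only [Set.preimage_univ, Set.univ_inter, ModelWithCorners.range_eq_univ, chartField]
  exact congrFun (lieBracketWithin_univ (E := EuclideanSpace ℝ (Fin n))) _

theorem fderiv_comp_extChartAt_symm (x : M) (X : ∀ x : M, TangentSpace (𝓡 n) x)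
    (u : C^∞⟮𝓡 n, M; ℝ⟯) :
    DifferentiableAt ℝ (u ∘ (extChartAt (𝓡 n) x).symm) (extChartAt (𝓡 n) x x) ∧
    fderiv ℝ (u ∘ (extChartAt (𝓡 n) x).symm) (extChartAt (𝓡 n) x x)
      (chartField n x X (extChartAt (𝓡 n) x x)) = differentialAt u x (X x) := by
  have := isManifold_one (n := n) (M := M)
  have hxs := mem_extChartAt_source (I := 𝓡 n) x
  have hF : DifferentiableAt ℝ (u ∘ (extChartAt (𝓡 n) x).symm) (extChartAt (𝓡 n) x x) := by
    have : ContDiffOn ℝ ∞ (u ∘ (extChartAt (𝓡 n) x).symm) (extChartAt (𝓡 n) x).target := by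
      rw [← contMDiffOn_iff_contDiffOn]
      exact u.contMDiff.comp_contMDiffOn (contMDiffOn_extChartAt_symm x)
    exact (this.contDiffAt ((isOpen_extChartAt_target x).mem_nhds
      (mem_extChartAt_target x))).differentiableAt (by simp)
  refine ⟨hF, ?_⟩
  rw [chartField_apply x X hxs]
  have hu : ⇑u =ᶠ[nhds x] (u ∘ (extChartAt (𝓡 n) x).symm) ∘ extChartAt (𝓡 n) x := by
    filter_upwards [extChartAt_source_mem_nhds (I := 𝓡 n) x] with z hz
    exact congrArg u ((extChartAt (𝓡 n) x).left_inv hz).symm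
  exact (mvfderiv_eq_of_hasMFDerivAt
    ((hasMFDerivAt_fderiv_comp (mdifferentiableAt_extChartAt (mem_chart_source _ x))
      hF.hasFDerivAt).congr_of_eventuallyEq hu) (X x)).symm

variable [T2Space M]

/-- Every covector is the differential of a function on which the commutator of any two smooth
vector fields acts as the commutator of derivations. A smooth vector field is one that maps smooth
functions to smooth functions. -/
theorem exists_differentialAt_mlieBracket (x : M) (γ : Module.Dual ℝ (TangentSpace (𝓡 n) x)) :
    ∃ h : C^∞⟮𝓡 n, M; ℝ⟯, differentialAt h x = γ ∧
      ∀ (X Y : ∀ x : M, TangentSpace (𝓡 n) x) (DX DY : C^∞⟮𝓡 n, M; ℝ⟯ → C^∞⟮𝓡 n, M; ℝ⟯),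
        (∀ u y, differentialAt u y (X y) = DX u y) → (∀ u y, differentialAt u y (Y y) = DY u y) →
        γ (mlieBracket (𝓡 n) X Y x) =
          differentialAt (DY h) x (X x) - differentialAt (DX h) x (Y x) := by
  have := isManifold_one (n := n) (M := M)
  obtain ⟨Φ, hΦ, hΦx⟩ := exists_globalChart (n := n) x
  have hinv := isInvertible_mfderiv_extChartAt (I := 𝓡 n) (mem_extChartAt_source (I := 𝓡 n) x)
  obtain ⟨e, he⟩ := hinv
  -- The test functions are linear in the chart near `x`, so their second derivatives vanish there
  -- and no symmetry argument is needed.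
  let H : (EuclideanSpace ℝ (Fin n) →L[ℝ] ℝ) → C^∞⟮𝓡 n, M; ℝ⟯ := fun l =>
    ⟨fun y => l (Φ y), l.contMDiff.comp hΦ⟩
  have hH : ∀ l, ∀ᶠ y in nhds x, ∀ v,
      differentialAt (H l) y v = l (mfderiv (𝓡 n) (𝓡 n) (extChartAt (𝓡 n) x) y v) := by
    intro l
    filter_upwards [hΦx.eventuallyEq_nhds] with y hy v
    rw [← hy.mfderiv_eq]
    exact mvfderiv_eq_of_hasMFDerivAt (hasMFDerivAt_fderiv_comp ((hΦ y).mdifferentiableAt (by simp))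
      l.hasFDerivAt) v
  let l : EuclideanSpace ℝ (Fin n) →L[ℝ] ℝ := LinearMap.toContinuousLinearMap
    (show EuclideanSpace ℝ (Fin n) →ₗ[ℝ] ℝ from γ ∘ₗ e.symm.toLinearMap)
  have hl : ∀ v, l (mfderiv (𝓡 n) (𝓡 n) (extChartAt (𝓡 n) x) x v) = γ v := by
    intro v
    rw [← he]
    change γ (e.symm (e v)) = γ v
    rw [e.symm_apply_apply]
  have hloc : ∀ (Z : ∀ x : M, TangentSpace (𝓡 n) x) (DZ : C^∞⟮𝓡 n, M; ℝ⟯ → C^∞⟮𝓡 n, M; ℝ⟯),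
      (∀ u y, differentialAt u y (Z y) = DZ u y) → ∀ k,
      (fun y => k (chartField n x Z y)) =ᶠ[nhds (extChartAt (𝓡 n) x x)]
        DZ (H k) ∘ (extChartAt (𝓡 n) x).symm := by
    intro Z DZ hZ k
    have hcont : Filter.Tendsto (extChartAt (𝓡 n) x).symm (nhds (extChartAt (𝓡 n) x x))
        (nhds x) := by
      simpa using (continuousAt_extChartAt_symm (I := 𝓡 n) x).tendsto
    filter_upwards [hcont.eventually (hH k), extChartAt_target_mem_nhds (I := 𝓡 n) x] with y hy hyt
    have h1 := chartField_apply x Z ((extChartAt (𝓡 n) x).map_target hyt)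
    rw [(extChartAt (𝓡 n) x).right_inv hyt] at h1
    rw [h1]
    exact (hy _).symm.trans (hZ _ _)
  -- With `k` a coordinate projection, `hloc` shows that each component of the chart field agrees
  -- near the centre with a smooth function read in the chart.
  have hdiff : ∀ (Z : ∀ x : M, TangentSpace (𝓡 n) x) (DZ : C^∞⟮𝓡 n, M; ℝ⟯ → C^∞⟮𝓡 n, M; ℝ⟯),
      (∀ u y, differentialAt u y (Z y) = DZ u y) →
      DifferentiableAt ℝ (chartField n x Z) (extChartAt (𝓡 n) x x) := by
    intro Z DZ hZ
    rw [differentiableAt_euclidean]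
    intro i
    exact (fderiv_comp_extChartAt_symm x Z _).1.congr_of_eventuallyEq
      (hloc Z DZ hZ (EuclideanSpace.proj (𝕜 := ℝ) i))
  have hder : ∀ (Z Z' : ∀ x : M, TangentSpace (𝓡 n) x)
      (DZ : C^∞⟮𝓡 n, M; ℝ⟯ → C^∞⟮𝓡 n, M; ℝ⟯), (∀ u y, differentialAt u y (Z y) = DZ u y) →
      l (fderiv ℝ (chartField n x Z) (extChartAt (𝓡 n) x x)
        (chartField n x Z' (extChartAt (𝓡 n) x x))) = differentialAt (DZ (H l)) x (Z' x) := by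
    intro Z Z' DZ hZ
    rw [← (fderiv_comp_extChartAt_symm x Z' _).2, ← (hloc Z DZ hZ l).fderiv_eq]
    have := (l.hasFDerivAt.comp _ (hdiff Z DZ hZ).hasFDerivAt).fderiv
    exact (congrArg (fun A => A (chartField n x Z' (extChartAt (𝓡 n) x x))) this).symm
  refine ⟨H l, ?_, fun X Y DX DY hX hY => ?_⟩
  · ext v
    rw [(hH l).self_of_nhds v, hl]
  · rw [← hl, mfderiv_extChartAt_mlieBracket, lieBracket, map_sub, hder Y X DY hY, hder X Y DX hX]

/-! ### The commutator modulo `π` and the proof of the equivalence. -/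

/-- Up to a factor, the commutator of two spanning fields is, modulo `π`, the contraction of
`[p, p]`. -/
theorem annihilator_mlieBracket_apply (p : BivectorField n M) {k l : ℕ}
    (φ f : Fin k → C^∞⟮𝓡 n, M; ℝ⟯) (ψ g : Fin l → C^∞⟮𝓡 n, M; ℝ⟯) (x : M)
    {γ : Module.Dual ℝ (TangentSpace (𝓡 n) x)}
    (hγ : γ ∈ (p.differentialSystem x).dualAnnihilator) :
    γ (mlieBracket (𝓡 n) (fun x => ∑ i, φ i x • p.hamiltonianField (f i) x)
      (fun x => ∑ j, ψ j x • p.hamiltonianField (g j) x) x) =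
    ∑ i, ∑ j, φ i x * ψ j x * (-(1 / 2) * Multivector.wedgeEval
      ![differentialAt (f i) x, differentialAt (g j) x, γ] (schoutenBracket p p x)) := by
  obtain ⟨h, rfl, hbr⟩ := exists_differentialAt_mlieBracket x γ
  have hzero : ∀ u, p.bracket u h x = 0 := fun u =>
    (Multivector.mem_range_bivectorSharp_dualAnnihilator_iff _ _).1 hγ _
  rw [hbr _ _ (spannedDerivation p φ f) (spannedDerivation p ψ g)
    (differentialAt_sum_smul_hamiltonianField p φ f)
    (differentialAt_sum_smul_hamiltonianField p ψ g),
    differentialAt_spannedDerivation p ψ g h x fun _ => hzero _,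
    differentialAt_spannedDerivation p φ f h x fun _ => hzero _]
  simp only [LinearMap.sum_apply, LinearMap.smul_apply, differentialAt_sum_smul_hamiltonianField,
    spannedDerivation_apply, smul_eq_mul, Finset.mul_sum]
  -- `X(Y h)` arrives with `j` as the outer index and `Y(X h)` with `i`, so the first sum is
  -- reordered.
  rw [Finset.sum_comm, ← Finset.sum_sub_distrib]
  refine Finset.sum_congr rfl fun i _ => ?_
  rw [← Finset.sum_sub_distrib]
  refine Finset.sum_congr rfl fun j _ => ?_
  have hswap : ∀ u v : C^∞⟮𝓡 n, M; ℝ⟯, p.bracket u v x = - p.bracket v u x := fun u v =>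
    Multivector.bivectorForm_swap _ _ _
  rw [wedgeEval_schoutenBracket]
  -- `hzero` kills `{{fᵢ, gⱼ}, h}`. The two other terms occur twice, since `[p, p] = p ∘ p + p ∘ p`,
  -- and with opposite sign; hence the factor `-1/2`.
  simp only [schoutenDerivation, compProd, ContMDiffMap.coe_add, ContMDiffMap.coe_sub,
    Pi.add_apply, Pi.sub_apply, hzero, hswap (f i) (p.bracket (g j) h),
    hswap (g j) (p.bracket (f i) h)]
  ring

end BivectorField

theorem mainTheorem5 {n : ℕ} {M : Type*} [TopologicalSpace M]
    [ChartedSpace (EuclideanSpace ℝ (Fin n)) M] [IsManifold (𝓡 n) ∞ M] [T2Space M]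
    (p : BivectorField n M) :
    p.IsInvolutive ↔
      ∀ x : M, BivectorField.schoutenBracket p p x ∈
        Multivector.wedgePower 3 (p.differentialSystem x) := by
  constructor
  · intro hp x
    rw [Multivector.mem_wedgePower_three_iff]
    intro α β γ hγ
    obtain ⟨f, rfl⟩ := BivectorField.differentialAt_surjective x α
    obtain ⟨g, rfl⟩ := BivectorField.differentialAt_surjective x β
    -- Single fields `p̃(df)` and `p̃(dg)` with coefficient `1` already detect every value of `[p,
    -- p]` on `α ∧ β ∧ γ`.
    have h := BivectorField.annihilator_mlieBracket_apply p (k := 1) (l := 1) (fun _ => 1)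
      (fun _ => f) (fun _ => 1) (fun _ => g) x hγ
    rw [(Submodule.mem_dualAnnihilator _).1 hγ _ (hp _ ⟨1, _, _, rfl⟩ _ ⟨1, _, _, rfl⟩ x)] at h
    simpa using h
  · rintro hp _ ⟨k, φ, f, rfl⟩ _ ⟨l, ψ, g, rfl⟩ x
    rw [← Subspace.forall_mem_dualAnnihilator_apply_eq_zero_iff]
    intro γ hγ
    rw [BivectorField.annihilator_mlieBracket_apply p φ f ψ g x hγ]
    refine Finset.sum_eq_zero fun i _ => Finset.sum_eq_zero fun j _ => ?_
    rw [(Multivector.mem_wedgePower_three_iff _ _).1 (hp x) _ _ _ hγ, mul_zero, mul_zero]
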